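/- Let $\mathbb{F}$ be an algebraically closed field of characteristic $0$, let $n\ge 2$ and $d\ge 2$, and let $f=[f_0:\dots:f_n]:\mathbb{P}^n\to\mathbb{P}^n$ be a morphism of algebraic degree $d$ over $\mathbb{F}$, i.e. the $f_i\in\mathbb{F}[x_0,\dots,x_n]$ are homogeneous of degree $d$ without common zero in $\mathbb{P}^n$. Let $$\mathcal{C}_f=\Bigl\{\det\Bigl(\frac{\partial f_i}{\partial x_j}\Bigr)=0\Bigr\}\subset\mathbb{P}^n\qquad\text{and}\qquad \mathcal{B}_f=f(\mathcal{C}_f)$$ be the critical locus and the branch locus of $f$. For a Zariski closed set $Z\subseteq\mathbb{P}^n$ and an integer $r\ge1$, say that $f|_Z$ is generically $r$-to-$1$ if there is a dense relatively open subset of $f(Z)$ (in the Zariski topology) over each point of which $f|_Z:Z\to f(Z)$ has exactly $r$ preimages. Let $H\subset\mathbb{P}^n$ be a hypersurface, i.e. the zero set of a nonzero homogeneous polynomial of positive degree (not necessarily irreducible), such that - $H$ is not contained in $\mathcal{C}_f$; - $f(H)$ is not contained in $\mathcal{B}_f$; - $f|_H$ is generically $r$-to-$1$ for some $r\ge 2$.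 Then there exist an integer $s$ with $1\le s<r$ and an automorphism $\alpha\in\operatorname{Aut}(\mathbb{P}^n)=\operatorname{PGL}_{n+1}(\mathbb{F})$ such that $f|_{\alpha(H)}$ is generically $s$-to-$1$. Moreover, there exists an automorphism $\alpha\in\operatorname{Aut}(\mathbb{P}^n)$ such that $f|_{\alpha(H)}$ is generically $1$-to-$1$. -/

import Mathlib

/-- The closed points of projective `n`-space over `F`, in homogeneous coordinates
`x_0, …, x_n`. -/
abbrev ProjSpace (F : Type*) [Field F] (n : ℕ) : Type _ :=
  Projectivization F (Fin (n + 1) → F)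

/-- A homogeneous polynomial of degree `k` scales by `t ^ k`. -/
theorem eval_smul_of_homogeneous {F : Type*} [Field F] {n k : ℕ}
    {p : MvPolynomial (Fin (n + 1)) F} (hp : p.IsHomogeneous k) (t : F) (v : Fin (n + 1) → F) :
    MvPolynomial.eval (t • v) p = t ^ k * MvPolynomial.eval v p := by
  rw [MvPolynomial.eval_eq, MvPolynomial.eval_eq, Finset.mul_sum]
  refine Finset.sum_congr rfl fun m hm => ?_
  have hk : ∑ i ∈ m.support, m i = k := by
    have h := hp (MvPolynomial.mem_support_iff.1 hm)
    rw [Finsupp.weight_apply, Finsupp.sum] at h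
    simpa using h
  simp only [Pi.smul_apply, smul_eq_mul, mul_pow, Finset.prod_mul_distrib]
  rw [Finset.prod_pow_eq_pow_sum, hk]
  ring

/-- Vanishing of a homogeneous polynomial at a vector depends only on the line it spans. -/
theorem eval_smul_eq_zero_iff {F : Type*} [Field F] {n k : ℕ}
    {p : MvPolynomial (Fin (n + 1)) F} (hp : p.IsHomogeneous k) (a : Fˣ) (v : Fin (n + 1) → F) :
    MvPolynomial.eval (a • v) p = 0 ↔ MvPolynomial.eval v p = 0 := by
  have h : MvPolynomial.eval (a • v) p = (a : F) ^ k * MvPolynomial.eval v p := 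
    eval_smul_of_homogeneous hp (a : F) v
  simp [h]

/-- The zero locus in projective space of a polynomial `p`, meant for homogeneous `p`. -/
def projZeroLocus {F : Type*} [Field F] {n : ℕ} (p : MvPolynomial (Fin (n + 1)) F) :
    Set (ProjSpace F n) :=
  {P | MvPolynomial.eval P.rep p = 0}

/-- For homogeneous `p` any representative vector may be used to test membership. -/
theorem mk_mem_projZeroLocus {F : Type*} [Field F] {n k : ℕ}
    {p : MvPolynomial (Fin (n + 1)) F} (hp : p.IsHomogeneous k) (v : Fin (n + 1) → F)
    (hv : v ≠ 0) :
    Projectivization.mk F v hv ∈ projZeroLocus p ↔ MvPolynomial.eval v p = 0 := by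
  obtain ⟨a, ha⟩ := Projectivization.exists_smul_eq_mk_rep F v hv
  change MvPolynomial.eval (Projectivization.mk F v hv).rep p = 0 ↔ _
  rw [← ha, eval_smul_eq_zero_iff hp]

/-- The Zariski topology on projective space: the complements of the zero loci of the
homogeneous polynomials form a basis of open sets. -/
instance zariskiTopology (F : Type*) [Field F] (n : ℕ) : TopologicalSpace (ProjSpace F n) :=
  TopologicalSpace.generateFrom
    {U | ∃ (k : ℕ) (p : MvPolynomial (Fin (n + 1)) F), p.IsHomogeneous k ∧ U = (projZeroLocus p)ᶜ}

/-- A hypersurface: the zero locus of a nonzero homogeneous polynomial of positive degree. It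
may be reducible; as a point set it is automatically reduced. -/
def IsHypersurface {F : Type*} [Field F] {n : ℕ} (H : Set (ProjSpace F n)) : Prop :=
  ∃ (e : ℕ) (p : MvPolynomial (Fin (n + 1)) F),
    1 ≤ e ∧ p ≠ 0 ∧ p.IsHomogeneous e ∧ H = projZeroLocus p

/-- A morphism `[f_0 : ⋯ : f_n]` from projective `n`-space to itself of algebraic degree `d`,
given by `n + 1` homogeneous polynomials of degree `d` without a common zero in projective space.
(Intended for algebraically closed `F`.) -/
structure ProjEnd (F : Type*) [Field F] (n d : ℕ) where
  /-- The coordinate polynomials. -/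
  coord : Fin (n + 1) → MvPolynomial (Fin (n + 1)) F
  homogeneous : ∀ i, (coord i).IsHomogeneous d
  no_common_zero : ∀ v : Fin (n + 1) → F, v ≠ 0 → ∃ i, MvPolynomial.eval v (coord i) ≠ 0

namespace ProjEnd

theorem eval_ne_zero {F : Type*} [Field F] {n d : ℕ} (f : ProjEnd F n d)
    (v : Fin (n + 1) → F) (hv : v ≠ 0) : (fun i => MvPolynomial.eval v (f.coord i)) ≠ 0 := by
  obtain ⟨i, hi⟩ := f.no_common_zero v hv
  exact fun h => hi (congrFun h i)

/-- The map on points, `[v] ↦ [f_0(v) : ⋯ : f_n(v)]`. -/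
noncomputable def toFun {F : Type*} [Field F] {n d : ℕ} (f : ProjEnd F n d) :
    ProjSpace F n → ProjSpace F n :=
  Projectivization.lift
    (fun v => Projectivization.mk F (fun i => MvPolynomial.eval v.1 (f.coord i))
      (f.eval_ne_zero v.1 v.2))
    (by
      intro a b t h
      refine (Projectivization.mk_eq_mk_iff' F _ _ _ _).2 ⟨t ^ d, ?_⟩
      funext i
      have e : MvPolynomial.eval (t • b.1) (f.coord i)
          = t ^ d * MvPolynomial.eval b.1 (f.coord i) := 
        eval_smul_of_homogeneous (f.homogeneous i) t b.1
      change t ^ d * MvPolynomial.eval b.1 (f.coord i) = MvPolynomial.eval a.1 (f.coord i)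
      rw [h, e])

noncomputable instance {F : Type*} [Field F] {n d : ℕ} :
    CoeFun (ProjEnd F n d) (fun _ => ProjSpace F n → ProjSpace F n) :=
  ⟨toFun⟩

/-- The Jacobian determinant `det (∂f_i/∂x_j)`. -/
noncomputable def jacobianDet {F : Type*} [Field F] {n d : ℕ} (f : ProjEnd F n d) :
    MvPolynomial (Fin (n + 1)) F :=
  (Matrix.of fun i j => MvPolynomial.pderiv j (f.coord i)).det

/-- The Jacobian determinant is homogeneous, so that its zero locus makes sense. -/
theorem jacobianDet_isHomogeneous {F : Type*} [Field F] {n d : ℕ} (f : ProjEnd F n d) :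
    f.jacobianDet.IsHomogeneous ((n + 1) * (d - 1)) := by
  unfold jacobianDet
  rw [Matrix.det_apply]
  refine MvPolynomial.IsHomogeneous.sum _ _ _ fun σ _ => ?_
  have h : (∏ i, (Matrix.of fun i j => MvPolynomial.pderiv j (f.coord i)) (σ i) i).IsHomogeneous
      (∑ _i : Fin (n + 1), (d - 1)) :=
    MvPolynomial.IsHomogeneous.prod _ _ _ fun i _ => (f.homogeneous (σ i)).pderiv
  simp only [Finset.sum_const, Finset.card_univ, Fintype.card_fin, smul_eq_mul] at h
  rcases Int.units_eq_one_or (Equiv.Perm.sign σ) with hs | hs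
  · rw [hs, one_smul]; exact h
  · rw [hs, Units.neg_smul, one_smul]; exact h.neg

/-- The critical locus of `f`: the vanishing locus of the Jacobian determinant. -/
def critLocus {F : Type*} [Field F] {n d : ℕ} (f : ProjEnd F n d) : Set (ProjSpace F n) :=
  projZeroLocus f.jacobianDet

/-- The branch locus of `f`: the image of the critical locus. -/
def branchLocus {F : Type*} [Field F] {n d : ℕ} (f : ProjEnd F n d) : Set (ProjSpace F n) :=
  f '' f.critLocus

end ProjEnd

/-- The restriction of `f` to `Z` is generically `r`-to-`1`: over the points of some dense
(relatively) open subset `f(Z) ∩ U` of the image `f(Z)`, the map `f|_Z : Z → f(Z)` has fibers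
with exactly `r` points. -/
def GenericallyToOne {F : Type*} [Field F] {n : ℕ} (f : ProjSpace F n → ProjSpace F n)
    (Z : Set (ProjSpace F n)) (r : ℕ) : Prop :=
  ∃ U : Set (ProjSpace F n), IsOpen U ∧ f '' Z ⊆ closure (f '' Z ∩ U) ∧
    ∀ q ∈ f '' Z ∩ U, (Z ∩ f ⁻¹' {q}).encard = (r : ℕ∞)

/-! One always reaches generic injectivity, so `s = 1` serves both claims. For `H = {p = 0}` and an
invertible matrix `A`, the hypersurface `{p (A x) = 0}` is a translate of `H`. Let `A` vary and
study the map `(A, x) ↦ (A, f x)` on the incidence variety `p (A x) = 0`; it is finite because the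
forms `f_i` have no common zero.

At one pair `(A₀, v₀)`, with `f` unramified at `v₀` and no other line of the cone over `f v₀`, the
affine fiber is the reduced set of the `ζ v₀`, `ζ ^ d = 1`. Nakayama's lemma then makes the powers
below `d` of a single coordinate generate the coordinate ring of the incidence variety near that
point of the base. Comparing the terms linear in `ζ` shows that nearby fibers also contain at most
one line (`exists_uniqueness_neighbourhood`).

Such pairs exist on every irreducible component of `H` (`exists_matrix_unique_in_fiber`). Each
component thus imposes a nonempty open condition on `A`, and finitely many of these can be met by a
single `A`. -/

/-! ### Nullstellensatz and reduced finite schemes -/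

theorem exists_eval_eq_zero_and_ne_zero_of_prime {F σ : Type*} [Field F] [IsAlgClosed F] [Finite σ]
    {p h : MvPolynomial σ F} (hp : Prime p) (hph : ¬ p ∣ h) :
    ∃ v, MvPolynomial.eval v p = 0 ∧ MvPolynomial.eval v h ≠ 0 := by
  by_contra! H
  apply hph
  have hprime : (Ideal.span {p}).IsPrime := (Ideal.span_singleton_prime hp.ne_zero).2 hp
  rw [← Ideal.mem_span_singleton, ← hprime.radical,
    ← MvPolynomial.vanishingIdeal_zeroLocus_eq_radical (K := F)]
  intro v hv
  simpa [MvPolynomial.aeval_eq_eval] using H v (by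
    simpa [MvPolynomial.aeval_eq_eval] using hv p (Ideal.mem_span_singleton_self p))

theorem eval_aeval_eq_eval {F τ ι : Type*} [CommRing F] (g : ι → MvPolynomial τ F) (v : τ → F)
    (D : MvPolynomial ι F) : MvPolynomial.eval v (MvPolynomial.aeval g D)
      = MvPolynomial.eval (fun i => MvPolynomial.eval v (g i)) D := by
  rw [← MvPolynomial.aeval_eq_eval, MvPolynomial.comp_aeval_apply]
  simp [MvPolynomial.aeval_eq_eval]

theorem prod_sup_le_sup_prod {R ι : Type*} [CommRing R] (I : Ideal R) (J : ι → Ideal R)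
    (s : Finset ι) : ∏ i ∈ s, (I ⊔ J i) ≤ I ⊔ ∏ i ∈ s, J i := by
  classical
  induction s using Finset.induction_on with
  | empty => simp
  | insert a s ha ih =>
    rw [Finset.prod_insert ha, Finset.prod_insert ha]
    refine (Ideal.mul_mono_right ih).trans ?_
    rw [Ideal.sup_mul, Ideal.mul_sup (J a)]
    exact sup_le (Ideal.mul_le_left.trans le_sup_left)
      (sup_le (Ideal.mul_le_right.trans le_sup_left) le_sup_right)

/-- If `I` has a finite zero locus and contains the maximal ideal of each of its zeros up to second
order, then `I` is a radical ideal. -/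
theorem vanishingIdeal_le_of_finite_of_forall_le_sup_sq {F σ : Type*} [Field F] [IsAlgClosed F]
    [Finite σ] (I : Ideal (MvPolynomial σ F))
    (hfin : (MvPolynomial.zeroLocus F I).Finite)
    (hI : ∀ v ∈ MvPolynomial.zeroLocus F I, MvPolynomial.vanishingIdeal F {v} ≤
      I ⊔ MvPolynomial.vanishingIdeal F {v} ^ 2) :
    MvPolynomial.vanishingIdeal F (MvPolynomial.zeroLocus F I) ≤ I := by
  set V := hfin.toFinset with hV
  let m : (σ → F) → Ideal (MvPolynomial σ F) := fun v => MvPolynomial.vanishingIdeal F {v}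
  have hrad := MvPolynomial.vanishingIdeal_zeroLocus_eq_radical (K := F) I
  have hcop : ∀ v ∈ V, ∀ w ∈ V, v ≠ w → m v ⊔ m w = ⊤ := by
    intro v _ w _ hvw
    refine Ideal.IsMaximal.coprime_of_ne (inferInstance) (inferInstance) fun h => hvw ?_
    funext i
    have : (MvPolynomial.X i - MvPolynomial.C (w i)) ∈ m v := by
      rw [h]
      simp [m]
    have := (MvPolynomial.mem_vanishingIdeal_singleton_iff v _).1 this
    simpa [sub_eq_zero] using this
  -- Distinct points have coprime maximal ideals, so their intersection is their product.
  have hM : MvPolynomial.vanishingIdeal F (MvPolynomial.zeroLocus F I) = ∏ v ∈ V, m v := by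
    rw [Ideal.prod_eq_iInf_of_pairwise_isCoprime]
    · ext p
      simp only [MvPolynomial.mem_vanishingIdeal_iff, Ideal.mem_iInf, m, V, Set.Finite.mem_toFinset,
        Set.mem_singleton_iff, forall_eq]
    · intro v hv w hw hvw
      exact Ideal.isCoprime_iff_sup_eq.2 (hcop v hv w hw hvw)
  set M := MvPolynomial.vanishingIdeal F (MvPolynomial.zeroLocus F I) with hMdef
  have hsq : M ≤ I ⊔ M ^ 2 := by
    rw [hM, ← Finset.prod_pow]
    refine le_trans ?_ (prod_sup_le_sup_prod I _ V)
    exact Finset.prod_le_prod' fun v hv => hI v (by simpa [V] using hv)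
  obtain ⟨k, hk⟩ := I.exists_radical_pow_le_of_fg (IsNoetherian.noetherian _)
  rw [← hrad] at hk
  -- Iterating `M ≤ I ⊔ M ^ 2` pushes the error into arbitrarily high powers of `M`; since `M` is
  -- the radical of `I`, some power already lies in `I`.
  have hpow : ∀ j : ℕ, M ≤ I ⊔ M ^ (j + 1) := by
    intro j
    induction j with
    | zero => simp
    | succ j ih =>
      have h1 : M ^ (j + 2) = M * M ^ (j + 1) := pow_succ' _ _
      refine hsq.trans (sup_le le_sup_left ?_)
      rw [pow_two, h1]
      calc M * M ≤ M * (I ⊔ M ^ (j + 1)) := Ideal.mul_mono_right ih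
        _ = M * I ⊔ M * M ^ (j + 1) := Ideal.mul_sup _ _ _
        _ ≤ _ := sup_le_sup_right Ideal.mul_le_right _
  exact (hpow k).trans (sup_le le_rfl ((Ideal.pow_le_pow_right (Nat.le_succ k)).trans hk))

/-! ### Finiteness of maps given by forms without common zero -/

theorem homogeneousComponent_mul_of_isHomogeneous {F σ : Type*} [CommRing F]
    {f : MvPolynomial σ F} {d : ℕ} (hf : f.IsHomogeneous d) (h : MvPolynomial σ F) (k : ℕ) :
    MvPolynomial.homogeneousComponent (k + d) (h * f)
      = MvPolynomial.homogeneousComponent k h * f := by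
  induction h using MvPolynomial.induction_on' with
  | monomial m a =>
    have hm := MvPolynomial.isHomogeneous_monomial (R := F) a (rfl : m.degree = m.degree)
    rw [MvPolynomial.homogeneousComponent_of_mem (hm.mul hf),
      MvPolynomial.homogeneousComponent_of_mem hm]
    simp [ite_mul]
  | add p q hp hq => rw [add_mul, map_add, hp, hq, map_add, add_mul]

/-- Homogeneous forms without a nontrivial common zero generate a subalgebra over which the whole
polynomial ring is a finite module. -/
theorem isIntegralElem_aeval_of_no_common_zero {F σ ι : Type*} [Field F] [IsAlgClosed F] [Finite σ]
    [Finite ι] (g : ι → MvPolynomial σ F) {d : ℕ} (hd : 1 ≤ d) (hg : ∀ i, (g i).IsHomogeneous d)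
    (h0 : ∀ v : σ → F, v ≠ 0 → ∃ i, MvPolynomial.eval v (g i) ≠ 0) (x : MvPolynomial σ F) :
    (MvPolynomial.aeval g : MvPolynomial ι F →ₐ[F] MvPolynomial σ F).toRingHom.IsIntegralElem x := by
  classical
  have := Fintype.ofFinite σ
  have := Fintype.ofFinite ι
  set φ : MvPolynomial ι F →ₐ[F] MvPolynomial σ F := MvPolynomial.aeval g
  let : Algebra (MvPolynomial ι F) φ.range := φ.rangeRestrict.toRingHom.toAlgebra
  set I := Ideal.span (Set.range g) with hI
  have hX : ∀ j, MvPolynomial.X j ∈ I.radical := by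
    intro j
    rw [← MvPolynomial.vanishingIdeal_zeroLocus_eq_radical (K := F)]
    intro v hv
    by_cases hv0 : v = 0
    · simp [hv0]
    obtain ⟨i, hi⟩ := h0 v hv0
    exact absurd (by simpa [MvPolynomial.aeval_eq_eval] using hv _ (Ideal.subset_span ⟨i, rfl⟩)) hi
  obtain ⟨N, hN⟩ := I.exists_radical_pow_le_of_fg (IsNoetherian.noetherian _)
  have hXN : ∀ j, (MvPolynomial.X j : MvPolynomial σ F) ^ N ∈ I :=
    fun j => hN (Ideal.pow_mem_pow (hX j) N)
  -- Above this degree some exponent is at least `N`, so the monomial lies in `I`; the extra `d`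
  -- leaves room to split off a factor `g i`.
  set K := Fintype.card σ * N + d with hK
  set B : Set (MvPolynomial σ F) :=
    (fun m : σ →₀ ℕ => MvPolynomial.monomial m (1 : F)) '' {m | m.degree ≤ K}
  have hB : B.Finite := (Finsupp.finite_of_degree_le K).image _
  set M : Submodule φ.range (MvPolynomial σ F) := Submodule.span φ.range B
  have hC : ∀ (a : F) (p : MvPolynomial σ F), p ∈ M → MvPolynomial.C a * p ∈ M := by
    intro a p hp
    have := M.smul_mem (algebraMap F φ.range a) hp
    simpa [Algebra.smul_def] using this
  have hmon : ∀ k, ∀ m : σ →₀ ℕ, m.degree = k → MvPolynomial.monomial m (1 : F) ∈ M := by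
    intro k
    induction k using Nat.strong_induction_on with
    | _ k ih =>
      intro m hm
      by_cases hk : k ≤ K
      · exact Submodule.subset_span ⟨m, by simpa [hm] using hk, rfl⟩
      have hex : ∃ j, N ≤ m j := by
        by_contra! hlt
        have : m.degree ≤ Fintype.card σ * N := by
          rw [Finsupp.degree_eq_sum]
          calc ∑ i, m i ≤ ∑ _i : σ, N := Finset.sum_le_sum fun i _ => (hlt i).le
            _ = _ := by simp
        omega
      obtain ⟨j, hj⟩ := hex
      have hmem : MvPolynomial.monomial m (1 : F) ∈ I := by
        have : MvPolynomial.monomial m (1 : F)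
            = MvPolynomial.monomial (m - Finsupp.single j N) 1 * MvPolynomial.X j ^ N := by
          rw [MvPolynomial.X_pow_eq_monomial, MvPolynomial.monomial_mul, one_mul,
            tsub_add_cancel_of_le]
          simpa using hj
        rw [this]
        exact I.mul_mem_left _ (hXN j)
      obtain ⟨c, hc⟩ := (Ideal.mem_span_range_iff_exists_fun).1 hmem
      obtain ⟨e, he⟩ : ∃ e, k = e + d := ⟨k - d, by omega⟩
      -- Taking the degree `k` part makes the coefficients homogeneous of degree `k - d`, where the
      -- induction hypothesis applies.
      have hcomp : MvPolynomial.monomial m (1 : F)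
          = ∑ i, MvPolynomial.homogeneousComponent e (c i) * g i := by
        have h1 := congrArg (MvPolynomial.homogeneousComponent k) hc
        rw [MvPolynomial.homogeneousComponent_of_mem
          (MvPolynomial.isHomogeneous_monomial (1 : F) hm), if_pos rfl, map_sum] at h1
        rw [← h1, he]
        exact Finset.sum_congr rfl fun i _ =>
          homogeneousComponent_mul_of_isHomogeneous (hg i) (c i) e
      rw [hcomp]
      refine M.sum_mem fun i _ => ?_
      have hgi : g i ∈ φ.range := ⟨MvPolynomial.X i, by simp [φ]⟩
      have hhom : MvPolynomial.homogeneousComponent e (c i) ∈ M := by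
        rw [MvPolynomial.homogeneousComponent_apply]
        refine M.sum_mem fun m' hm' => ?_
        have := hC ((c i).coeff m') _ (ih e (by omega) m' (Finset.mem_filter.1 hm').2)
        rwa [MvPolynomial.C_mul_monomial, mul_one] at this
      have := M.smul_mem (⟨g i, hgi⟩ : φ.range) hhom
      rwa [Subalgebra.smul_def, smul_eq_mul, mul_comm] at this
  have hM : M = ⊤ := by
    rw [eq_top_iff]
    intro p _
    induction p using MvPolynomial.induction_on' with
    | monomial m a =>
      have := hC a _ (hmon _ m rfl)
      rwa [MvPolynomial.C_mul_monomial, mul_one] at this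
    | add p q hp hq => exact M.add_mem (hp trivial) (hq trivial)
  have : Module.Finite φ.range (MvPolynomial σ F) :=
    ⟨hM ▸ Submodule.fg_span hB⟩
  obtain ⟨P, hP, hPx⟩ := IsIntegral.of_finite φ.range x
  -- The monic equation has coefficients in the image of `φ`; lift it to a monic one over the
  -- source.
  obtain ⟨Q, hQP, -, hQ⟩ := Polynomial.lifts_and_natDegree_eq_and_monic
    (f := φ.rangeRestrict.toRingHom) (p := P) ((Polynomial.mem_lifts P).2
      (Polynomial.map_surjective _ φ.rangeRestrict_surjective P)) hP
  refine ⟨Q, hQ, ?_⟩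
  rw [← hQP, Polynomial.eval₂_map] at hPx
  exact hPx

/-! ### First-order expansion and Nakayama's lemma over a reduced fiber -/

/-- By induction on `g`: multiplying by `X i` changes the remainder only by products `(X j - v j) *
(X i - v i)`. This turns derivatives into statements about the cotangent space at `v`. -/
theorem sub_taylor_mem_sq {F σ : Type*} [Field F] [Fintype σ] (v : σ → F) (g : MvPolynomial σ F) :
    g - MvPolynomial.C (MvPolynomial.eval v g) - ∑ j, MvPolynomial.C
      (MvPolynomial.eval v (MvPolynomial.pderiv j g)) * (MvPolynomial.X j - MvPolynomial.C (v j))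
      ∈ MvPolynomial.vanishingIdeal F {v} ^ 2 := by
  classical
  have hX : ∀ j, (MvPolynomial.X j - MvPolynomial.C (v j) : MvPolynomial σ F)
      ∈ MvPolynomial.vanishingIdeal F {v} := fun j => by simp
  induction g using MvPolynomial.induction_on with
  | C a => simp
  | add p q hp hq =>
    convert! Ideal.add_mem _ hp hq using 1
    simp only [map_add, add_mul, Finset.sum_add_distrib]
    ring
  | mul_X p i hp =>
    have h1 := Ideal.mul_mem_right (MvPolynomial.X i) _ hp
    have h2 : ∑ j, MvPolynomial.C (MvPolynomial.eval v (MvPolynomial.pderiv j p)) *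
        ((MvPolynomial.X j - MvPolynomial.C (v j)) * (MvPolynomial.X i - MvPolynomial.C (v i)))
        ∈ MvPolynomial.vanishingIdeal F {v} ^ 2 := by
      refine Ideal.sum_mem _ fun j _ => Ideal.mul_mem_left _ _ ?_
      rw [pow_two]
      exact Ideal.mul_mem_mul (hX j) (hX i)
    convert! Ideal.add_mem _ h1 h2 using 1
    simp only [Derivation.leibniz, MvPolynomial.pderiv_X, smul_eq_mul, map_add, map_mul,
      MvPolynomial.eval_X, add_mul, Finset.sum_add_distrib, sub_mul, Finset.sum_mul, mul_sub,
      Finset.sum_sub_distrib, Pi.single_apply, apply_ite, map_one, map_zero]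
    simp [Finset.sum_ite_eq, ite_mul]
    have e : ∀ x : σ, MvPolynomial.C (v i) * MvPolynomial.C
        ((MvPolynomial.eval v) ((MvPolynomial.pderiv x) p)) * MvPolynomial.X x
        = MvPolynomial.C ((MvPolynomial.eval v) ((MvPolynomial.pderiv x) p)) *
          (MvPolynomial.X x * MvPolynomial.C (v i)) := fun x => by ring
    simp only [e]
    ring_nf

/-- If over the point `g pt` the zero locus of `G` is finite, reduced, of at most `d` points, and
separated by `l`, then over a neighbourhood of that point the powers `1, l, …, l ^ (d - 1)` generate
the coordinate ring of the zero locus of `G` as a module. -/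
theorem exists_mul_eq_sum_pow_add_of_fiber {F τ ι : Type*} [Field F] [IsAlgClosed F] [Finite τ]
    [Fintype ι] (g : ι → MvPolynomial τ F)
    (hint : ∀ x, (MvPolynomial.aeval g :
      MvPolynomial ι F →ₐ[F] MvPolynomial τ F).toRingHom.IsIntegralElem x)
    (G l : MvPolynomial τ F) (pt : τ → F) {d : ℕ} (hd : 0 < d) (V : Finset (τ → F))
    (hV : ∀ v, v ∈ V ↔
      (∀ i, MvPolynomial.eval v (g i) = MvPolynomial.eval pt (g i)) ∧ MvPolynomial.eval v G = 0)
    (hcard : V.card ≤ d) (hl : Set.InjOn (fun v => MvPolynomial.eval v l) V)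
    (htan : ∀ v ∈ V, MvPolynomial.vanishingIdeal F {v} ≤
      (Ideal.span (Set.range fun i => g i - MvPolynomial.C (MvPolynomial.eval pt (g i))) ⊔
        Ideal.span {G}) ⊔ MvPolynomial.vanishingIdeal F {v} ^ 2) :
    ∃ D : MvPolynomial ι F, MvPolynomial.eval (fun i => MvPolynomial.eval pt (g i)) D ≠ 0 ∧
      ∀ s, ∃ (c : Fin d → MvPolynomial ι F) (h : MvPolynomial τ F),
        MvPolynomial.aeval g D * s = ∑ k, MvPolynomial.aeval g (c k) * l ^ (k : ℕ) + G * h := by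
  classical
  set φ : MvPolynomial ι F →ₐ[F] MvPolynomial τ F := MvPolynomial.aeval g with hφ
  set I := Ideal.span (Set.range fun i => g i - MvPolynomial.C (MvPolynomial.eval pt (g i))) ⊔
        Ideal.span {G} with hI
  have hZ : MvPolynomial.zeroLocus F I = V := by
    ext v
    rw [hI, ← Ideal.span_union, MvPolynomial.zeroLocus_span, Finset.mem_coe, hV]
    simp [MvPolynomial.aeval_eq_eval, sub_eq_zero, or_imp, forall_and, and_comm]
  have hrad := vanishingIdeal_le_of_finite_of_forall_le_sup_sq I
    (by rw [hZ]; exact V.finite_toSet) (fun v hv => htan v (by rwa [hZ] at hv))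
  have hintR : Algebra.IsIntegral φ.range (MvPolynomial τ F) := by
    refine ⟨fun x => ?_⟩
    obtain ⟨P, hP, hPx⟩ := hint x
    refine ⟨P.map φ.rangeRestrict.toRingHom, hP.map _, ?_⟩
    rw [Polynomial.eval₂_map]
    exact hPx
  have hft : Algebra.FiniteType φ.range (MvPolynomial τ F) :=
    Algebra.FiniteType.of_restrictScalars_finiteType F _ _
  have hfin : Module.Finite φ.range (MvPolynomial τ F) := Algebra.IsIntegral.finite
  set ev : φ.range →+* F := (MvPolynomial.eval pt).comp φ.range.val.toRingHom with hev
  set N : Submodule φ.range (MvPolynomial τ F) :=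
    Submodule.span φ.range (Set.range fun k : Fin d => l ^ (k : ℕ)) ⊔
      (Ideal.span {G}).restrictScalars φ.range with hN
  -- The Nakayama hypothesis: modulo the ideal of the base point, every `s` agrees with the
  -- polynomial in `l` interpolating its values on the fiber. The difference vanishes on the fiber,
  -- hence lies in `I` because the fiber is reduced.
  have hgen : (⊤ : Submodule φ.range (MvPolynomial τ F)) ≤ N ⊔ (RingHom.ker ev) • ⊤ := by
    intro s _
    set P := Lagrange.interpolate V (fun v => MvPolynomial.eval v l)
      (fun v => MvPolynomial.eval v s) with hP
    have hdeg : P.natDegree < d := by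
      have h1 : P.degree < V.card := Lagrange.degree_interpolate_lt _ hl
      by_cases h0 : P = 0
      · simpa [h0] using hd
      · exact ((Polynomial.natDegree_lt_iff_degree_lt h0).2 h1).trans_le hcard
    set q := Polynomial.aeval l P with hq
    have hqN : q ∈ N := by
      rw [hq, Polynomial.aeval_eq_sum_range' hdeg, Finset.sum_range]
      refine Submodule.mem_sup_left (Submodule.sum_mem _ fun k _ => ?_)
      exact Submodule.smul_of_tower_mem _ _ (Submodule.subset_span ⟨k, rfl⟩)
    have hsq : s - q ∈ I := by
      refine hrad fun v hv => ?_
      rw [hZ] at hv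
      have h1 : MvPolynomial.aeval v q = Polynomial.eval (MvPolynomial.eval v l) P := by
        rw [hq, ← Polynomial.aeval_algHom_apply]
        simp [MvPolynomial.aeval_eq_eval]
      rw [map_sub, h1, hP, Lagrange.eval_interpolate_at_node (v := fun v => MvPolynomial.eval v l)
        _ hl hv]
      simp [MvPolynomial.aeval_eq_eval]
    obtain ⟨a, ha, b, hb, hab⟩ := Submodule.mem_sup.1 hsq
    have haN : a ∈ (RingHom.ker ev) • (⊤ : Submodule φ.range (MvPolynomial τ F)) := by
      obtain ⟨c, rfl⟩ := (Ideal.mem_span_range_iff_exists_fun).1 ha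
      refine Submodule.sum_mem _ fun i _ => ?_
      have hmem : g i - MvPolynomial.C (MvPolynomial.eval pt (g i)) ∈ φ.range :=
        ⟨MvPolynomial.X i - MvPolynomial.C (MvPolynomial.eval pt (g i)), by simp [hφ]⟩
      have := Submodule.smul_mem_smul (I := RingHom.ker ev)
        (N := (⊤ : Submodule φ.range (MvPolynomial τ F)))
        (r := ⟨_, hmem⟩) (n := c i) (by simp [RingHom.mem_ker, hev]) trivial
      rwa [Subalgebra.smul_def, smul_eq_mul, mul_comm] at this
    have : s = q + b + a := by rw [add_assoc, add_comm b a, hab]; ring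
    rw [this]
    exact Submodule.add_mem_sup (N.add_mem hqN (Submodule.mem_sup_right hb)) haN
  -- Nakayama gives a denominator congruent to `1` at the base point, so its value there is `1`.
  obtain ⟨D', hD1, hD2⟩ := Submodule.exists_sub_one_mem_and_smul_le_of_fg_of_le_sup
    hfin.fg_top le_rfl hgen
  obtain ⟨⟨D, hD⟩⟩ : Nonempty {D // φ.rangeRestrict D = D'} :=
    let ⟨D, hD⟩ := φ.rangeRestrict_surjective D'; ⟨⟨D, hD⟩⟩
  have hDval : (D' : MvPolynomial τ F) = φ D := by rw [← hD]; rfl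
  refine ⟨D, ?_, fun s => ?_⟩
  · have h1 : MvPolynomial.eval pt ((D' : MvPolynomial τ F) - 1) = 0 := hD1
    rw [hDval, map_sub, map_one, sub_eq_zero, hφ, eval_aeval_eq_eval] at h1
    rw [h1]
    exact one_ne_zero
  · have h1 : D' • s ∈ N := hD2 (Submodule.smul_mem_pointwise_smul s D' ⊤ trivial)
    obtain ⟨a, ha, b, hb, hab⟩ := Submodule.mem_sup.1 h1
    obtain ⟨c, rfl⟩ := (Submodule.mem_span_range_iff_exists_fun _).1 ha
    obtain ⟨h, rfl⟩ := Ideal.mem_span_singleton'.1 hb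
    choose c' hc' using fun k => φ.rangeRestrict_surjective (c k)
    refine ⟨c', h, ?_⟩
    rw [Subalgebra.smul_def, smul_eq_mul, hDval] at hab
    rw [← hab, mul_comm h G]
    congr 1
    refine Finset.sum_congr rfl fun k _ => ?_
    rw [Subalgebra.smul_def, smul_eq_mul, ← hc' k]
    rfl

/-! ### The incidence variety of pairs (matrix, vector) -/

section Incidence

variable {F : Type*} {n d : ℕ}

/-- The point with matrix part `A` and vector part `v` of the space of pairs (matrix, vector). -/
def pairPoint (A : Matrix (Fin (n + 1)) (Fin (n + 1)) F) (v : Fin (n + 1) → F) :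
    (Fin (n + 1) × Fin (n + 1)) ⊕ Fin (n + 1) → F :=
  Sum.elim (fun ij => A ij.1 ij.2) v

theorem pairPoint_injective {A A' : Matrix (Fin (n + 1)) (Fin (n + 1)) F}
    {v v' : Fin (n + 1) → F} (h : pairPoint A v = pairPoint A' v') : A = A' ∧ v = v' :=
  ⟨Matrix.ext fun i j => congrFun h (Sum.inl (i, j)), funext fun i => congrFun h (Sum.inr i)⟩

theorem exists_eq_pairPoint (w : (Fin (n + 1) × Fin (n + 1)) ⊕ Fin (n + 1) → F) :
    ∃ A v, w = pairPoint A v :=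
  ⟨Matrix.of fun i j => w (Sum.inl (i, j)), fun i => w (Sum.inr i), by
    funext i; rcases i with ij | i <;> rfl⟩

variable [Field F]

/-- The polynomial `p (A x)` in the entries of the matrix `A` and the coordinates `x`. -/
noncomputable def genericTwist (p : MvPolynomial (Fin (n + 1)) F) :
    MvPolynomial ((Fin (n + 1) × Fin (n + 1)) ⊕ Fin (n + 1)) F :=
  MvPolynomial.aeval (fun i => ∑ j, MvPolynomial.X (Sum.inl (i, j)) * MvPolynomial.X (Sum.inr j)) p

theorem eval_genericTwist (p : MvPolynomial (Fin (n + 1)) F)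
    (A : Matrix (Fin (n + 1)) (Fin (n + 1)) F) (v : Fin (n + 1) → F) :
    MvPolynomial.eval (pairPoint A v) (genericTwist p) = MvPolynomial.eval (A.mulVec v) p := by
  rw [genericTwist, eval_aeval_eq_eval]
  congr 2
  funext i
  simp [pairPoint, Matrix.mulVec, dotProduct]

/-- The coordinates of the map `(A, x) ↦ (A, f x)`. -/
noncomputable def familyCoord (f : ProjEnd F n d) :
    (Fin (n + 1) × Fin (n + 1)) ⊕ Fin (n + 1) →
      MvPolynomial ((Fin (n + 1) × Fin (n + 1)) ⊕ Fin (n + 1)) F :=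
  Sum.elim (fun ij => MvPolynomial.X (Sum.inl ij))
    (fun i => MvPolynomial.rename Sum.inr (f.coord i))

/-- The map `f` on vectors. -/
noncomputable def ProjEnd.vec (f : ProjEnd F n d) (v : Fin (n + 1) → F) : Fin (n + 1) → F :=
  fun i => MvPolynomial.eval v (f.coord i)

theorem ProjEnd.vec_smul (f : ProjEnd F n d) (t : F) (v : Fin (n + 1) → F) :
    f.vec (t • v) = t ^ d • f.vec v := by
  funext i
  exact eval_smul_of_homogeneous (f.homogeneous i) t v

theorem eval_familyCoord (f : ProjEnd F n d) (A : Matrix (Fin (n + 1)) (Fin (n + 1)) F)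
    (v : Fin (n + 1) → F) :
    (fun i => MvPolynomial.eval (pairPoint A v) (familyCoord f i)) = pairPoint A (f.vec v) := by
  funext i
  rcases i with ij | i
  · simp [familyCoord, pairPoint]
  · simp only [familyCoord, pairPoint, Sum.elim_inr, MvPolynomial.eval_rename, ProjEnd.vec]
    rfl

/-- Matrix entries are their own images, and each vector coordinate inherits its monic equation from
`f`. -/
theorem isIntegralElem_aeval_familyCoord [IsAlgClosed F] (hd : 1 ≤ d) (f : ProjEnd F n d)
    (x : MvPolynomial ((Fin (n + 1) × Fin (n + 1)) ⊕ Fin (n + 1)) F) :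
    (MvPolynomial.aeval (familyCoord f) :
      MvPolynomial ((Fin (n + 1) × Fin (n + 1)) ⊕ Fin (n + 1)) F →ₐ[F]
      MvPolynomial ((Fin (n + 1) × Fin (n + 1)) ⊕ Fin (n + 1)) F).toRingHom.IsIntegralElem x := by
  set φ : MvPolynomial ((Fin (n + 1) × Fin (n + 1)) ⊕ Fin (n + 1)) F →ₐ[F]
      MvPolynomial ((Fin (n + 1) × Fin (n + 1)) ⊕ Fin (n + 1)) F :=
    MvPolynomial.aeval (familyCoord f) with hφ
  induction x using MvPolynomial.induction_on with
  | C a =>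
    have : φ.toRingHom (MvPolynomial.C a) = MvPolynomial.C a := by simp [hφ]
    rw [← this]
    exact RingHom.isIntegralElem_map _
  | add p q hp hq => exact hp.add _ hq
  | mul_X p i hp =>
    refine hp.mul _ ?_
    rcases i with ij | j
    · have : φ.toRingHom (MvPolynomial.X (Sum.inl ij)) = MvPolynomial.X (Sum.inl ij) := by
        simp [hφ, familyCoord]
      rw [← this]
      exact RingHom.isIntegralElem_map _
    · obtain ⟨P, hP, hPx⟩ := isIntegralElem_aeval_of_no_common_zero f.coord hd f.homogeneous
        f.no_common_zero (MvPolynomial.X j)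
      set ρ : MvPolynomial (Fin (n + 1)) F →ₐ[F]
        MvPolynomial ((Fin (n + 1) × Fin (n + 1)) ⊕ Fin (n + 1)) F := MvPolynomial.rename Sum.inr
      refine ⟨P.map ρ.toRingHom, hP.map _, ?_⟩
      have hcomp : φ.toRingHom.comp ρ.toRingHom
          = ρ.toRingHom.comp (MvPolynomial.aeval f.coord : MvPolynomial (Fin (n + 1)) F →ₐ[F]
            MvPolynomial (Fin (n + 1)) F).toRingHom := by
        refine MvPolynomial.ringHom_ext (fun a => ?_) (fun i => ?_)
        · simp [hφ, ρ]
        · simp [hφ, ρ, familyCoord]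
      have hX : ρ.toRingHom (MvPolynomial.X j) = MvPolynomial.X (Sum.inr j) := by simp [ρ]
      rw [Polynomial.eval₂_map, hcomp, ← hX, ← Polynomial.hom_eval₂, hPx, map_zero]

/-- An invertible Jacobian at `v` means that the differentials of the coordinates of `(A, x) ↦ (A, f
x)` span the cotangent space: this is unramifiedness, the reducedness input for Nakayama. -/
theorem vanishingIdeal_pairPoint_le (f : ProjEnd F n d)
    (A : Matrix (Fin (n + 1)) (Fin (n + 1)) F) (v : Fin (n + 1) → F)
    (hJ : MvPolynomial.eval v f.jacobianDet ≠ 0) :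
    MvPolynomial.vanishingIdeal F {pairPoint A v} ≤
      Ideal.span (Set.range fun i => familyCoord f i -
        MvPolynomial.C (MvPolynomial.eval (pairPoint A v) (familyCoord f i))) ⊔
      MvPolynomial.vanishingIdeal F {pairPoint A v} ^ 2 := by
  classical
  set pt := pairPoint A v with hpt
  set I := Ideal.span (Set.range fun i => familyCoord f i -
        MvPolynomial.C (MvPolynomial.eval pt (familyCoord f i))) with hI
  set Q := I ⊔ MvPolynomial.vanishingIdeal F {pt} ^ 2 with hQ
  have hgen : ∀ i, familyCoord f i - MvPolynomial.C (MvPolynomial.eval pt (familyCoord f i)) ∈ Q :=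
    fun i => Ideal.mem_sup_left (Ideal.subset_span ⟨i, rfl⟩)
  have hinl : ∀ ij, MvPolynomial.X (Sum.inl ij) - MvPolynomial.C (pt (Sum.inl ij)) ∈ Q := by
    intro ij
    simpa [familyCoord] using hgen (Sum.inl ij)
  set J : Matrix (Fin (n + 1)) (Fin (n + 1)) F :=
    Matrix.of fun i j => MvPolynomial.eval v (MvPolynomial.pderiv j (f.coord i)) with hJdef
  have hdet : IsUnit J.det := by
    have : J.det = MvPolynomial.eval v f.jacobianDet := by
      rw [ProjEnd.jacobianDet, RingHom.map_det]
      rfl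
    rw [this]
    exact hJ.isUnit
  have hrow : ∀ i, ∑ j, MvPolynomial.C (J i j) *
      (MvPolynomial.X (Sum.inr j) - MvPolynomial.C (pt (Sum.inr j))) ∈ Q := by
    intro i
    have h1 := sub_taylor_mem_sq pt (familyCoord f (Sum.inr i))
    rw [Fintype.sum_sum_type] at h1
    have h2 : ∀ j, MvPolynomial.eval pt (MvPolynomial.pderiv (Sum.inr j)
        (familyCoord f (Sum.inr i))) = J i j := by
      intro j
      simp only [familyCoord, Sum.elim_inr]
      rw [MvPolynomial.pderiv_rename Sum.inr_injective, MvPolynomial.eval_rename]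
      rfl
    simp only [h2] at h1
    have h3 : ∑ ij, MvPolynomial.C (MvPolynomial.eval pt (MvPolynomial.pderiv (Sum.inl ij)
        (familyCoord f (Sum.inr i)))) *
        (MvPolynomial.X (Sum.inl ij) - MvPolynomial.C (pt (Sum.inl ij))) ∈ Q :=
      Ideal.sum_mem _ fun ij _ => Ideal.mul_mem_left _ _ (hinl ij)
    have h4 := Ideal.sub_mem _ (Ideal.sub_mem _ (hgen (Sum.inr i)) h3)
      ((le_sup_right : _ ≤ Q) h1)
    convert! h4 using 1
    ring
  -- Apply the inverse Jacobian to the linearised equations.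
  have hinr : ∀ k, MvPolynomial.X (Sum.inr k) - MvPolynomial.C (pt (Sum.inr k)) ∈ Q := by
    intro k
    have h1 : ∑ i, MvPolynomial.C (J⁻¹ k i) * ∑ j, MvPolynomial.C (J i j) *
      (MvPolynomial.X (Sum.inr j) - MvPolynomial.C (pt (Sum.inr j))) ∈ Q :=
      Ideal.sum_mem _ fun i _ => Ideal.mul_mem_left _ _ (hrow i)
    convert! h1 using 1
    simp only [Finset.mul_sum, ← mul_assoc, ← map_mul]
    rw [Finset.sum_comm]
    simp only [← Finset.sum_mul, ← map_sum, ← Matrix.mul_apply, Matrix.nonsing_inv_mul J hdet,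
      Matrix.one_apply]
    simp [apply_ite]
  intro g hg
  have h1 := sub_taylor_mem_sq pt g
  have h0 : MvPolynomial.eval pt g = 0 := (MvPolynomial.mem_vanishingIdeal_singleton_iff pt g).1 hg
  rw [h0, map_zero, sub_zero] at h1
  have h2 : ∑ j, MvPolynomial.C (MvPolynomial.eval pt (MvPolynomial.pderiv j g)) *
      (MvPolynomial.X j - MvPolynomial.C (pt j)) ∈ Q := by
    refine Ideal.sum_mem _ fun j _ => Ideal.mul_mem_left _ _ ?_
    rcases j with ij | j
    · exact hinl ij
    · exact hinr j
  have h3 := Ideal.add_mem _ ((le_sup_right : _ ≤ Q) h1) h2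
  rwa [sub_add_cancel] at h3

/-- Two polynomials in `ζ` of degree below `d` that agree at the `d` distinct roots of unity are
equal; compare the coefficients of `ζ`. -/
theorem coeff_eq_of_forall_root_of_unity [IsAlgClosed F] [CharZero F] (hd : 2 ≤ d) (c : Fin d → F)
    (a : F) (h : ∀ ζ : F, ζ ^ d = 1 → ζ * a = ∑ k, c k * ζ ^ (k : ℕ)) : a = c ⟨1, hd⟩ := by
  have hne : NeZero d := ⟨by omega⟩
  obtain ⟨ζ, hζ⟩ := HasEnoughRootsOfUnity.exists_primitiveRoot F d
  set q : Polynomial F := ∑ k : Fin d, Polynomial.monomial (k : ℕ) (c k) -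
    Polynomial.monomial 1 a with hq
  have hdeg : q.natDegree < Fintype.card (Fin d) := by
    rw [Fintype.card_fin, hq]
    refine lt_of_le_of_lt (b := d - 1) ?_ (by omega)
    refine (Polynomial.natDegree_sub_le _ _).trans (max_le ?_ ?_)
    · refine Polynomial.natDegree_sum_le_of_forall_le _ _ fun k _ => ?_
      exact (Polynomial.natDegree_monomial_le _).trans (by omega)
    · exact (Polynomial.natDegree_monomial_le _).trans (by omega)
  have hq0 : q = 0 := by
    refine Polynomial.eq_zero_of_natDegree_lt_card_of_eval_eq_zero q
      (f := fun i : Fin d => ζ ^ (i : ℕ)) ?_ ?_ hdeg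
    · intro i j hij
      exact Fin.ext (hζ.pow_inj i.2 j.2 hij)
    · intro i
      have := h (ζ ^ (i : ℕ)) (by rw [← pow_mul, mul_comm, pow_mul, hζ.pow_eq_one, one_pow])
      rw [hq, Polynomial.eval_sub, Polynomial.eval_finsetSum]
      simp only [Polynomial.eval_monomial, pow_one]
      rw [← this]
      ring
  have := congrArg (fun q => Polynomial.coeff q 1) hq0
  simp only [hq, Polynomial.coeff_sub, Polynomial.finsetSum_coeff, Polynomial.coeff_monomial,
    Polynomial.coeff_zero, if_true, sub_eq_zero] at this
  rw [← this, Finset.sum_eq_single ⟨1, hd⟩]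
  · simp
  · intro k _ hk
    exact if_neg fun h => hk (Fin.ext h)
  · simp

/-- If `f` is unramified at `v₀` and `v₀` spans the only line of the cone `p (A₀ x) = 0` lying over
`f v₀`, then the same uniqueness holds for all cones `p (A x) = 0` and all points near `(A₀, f v₀)`.
-/
theorem exists_uniqueness_neighbourhood [IsAlgClosed F] [CharZero F] (hd : 2 ≤ d)
    (f : ProjEnd F n d) {e : ℕ} {p : MvPolynomial (Fin (n + 1)) F} (hp : p.IsHomogeneous e)
    (A₀ : Matrix (Fin (n + 1)) (Fin (n + 1)) F) (v₀ : Fin (n + 1) → F) (hv₀ : v₀ ≠ 0)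
    (hJ : MvPolynomial.eval v₀ f.jacobianDet ≠ 0)
    (hpv₀ : MvPolynomial.eval (A₀.mulVec v₀) p = 0)
    (huniq : ∀ v, f.vec v = f.vec v₀ → MvPolynomial.eval (A₀.mulVec v) p = 0 → ∃ t : F, v = t • v₀) :
    ∃ D : MvPolynomial ((Fin (n + 1) × Fin (n + 1)) ⊕ Fin (n + 1)) F,
      MvPolynomial.eval (pairPoint A₀ (f.vec v₀)) D ≠ 0 ∧
      ∀ A v v', v ≠ 0 → MvPolynomial.eval (A.mulVec v) p = 0 →
        MvPolynomial.eval (A.mulVec v') p = 0 → f.vec v = f.vec v' →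
        MvPolynomial.eval (pairPoint A (f.vec v)) D ≠ 0 → ∃ t : F, v' = t • v := by
  classical
  have hcone : ∀ (A : Matrix (Fin (n + 1)) (Fin (n + 1)) F) v (t : F),
      MvPolynomial.eval (A.mulVec v) p = 0 → MvPolynomial.eval (A.mulVec (t • v)) p = 0 := by
    intro A v t h
    rw [Matrix.mulVec_smul, eval_smul_of_homogeneous hp, h, mul_zero]
  obtain ⟨k, hk⟩ := Function.ne_iff.1 hv₀
  have hk : v₀ k ≠ 0 := hk
  have hf0 : f.vec v₀ ≠ 0 := f.eval_ne_zero v₀ hv₀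
  -- By homogeneity and `huniq`, this is the whole affine fiber over `(A₀, f v₀)`. The coordinate
  -- `k`, nonzero at `v₀`, separates its points.
  set V := (Polynomial.nthRootsFinset d (1 : F)).image fun ζ => pairPoint A₀ (ζ • v₀) with hV
  have hroot : ∀ ζ : F, ζ ∈ Polynomial.nthRootsFinset d (1 : F) ↔ ζ ^ d = 1 := fun ζ =>
    Polynomial.mem_nthRootsFinset (by omega) 1
  obtain ⟨D, hD0, hD⟩ := exists_mul_eq_sum_pow_add_of_fiber (familyCoord f)
    (isIntegralElem_aeval_familyCoord (by omega) f) (genericTwist p)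
    (MvPolynomial.X (Sum.inr k)) (pairPoint A₀ v₀) (d := d) (by omega) V
    (by
      intro w
      obtain ⟨A, v, rfl⟩ := exists_eq_pairPoint w
      rw [← funext_iff, eval_familyCoord, eval_familyCoord, eval_genericTwist]
      constructor
      · intro h
        obtain ⟨ζ, hζ, hw⟩ := Finset.mem_image.1 h
        obtain ⟨rfl, rfl⟩ := pairPoint_injective hw
        rw [f.vec_smul, (hroot ζ).1 hζ, one_smul]
        exact ⟨rfl, hcone _ _ _ hpv₀⟩
      · rintro ⟨h1, h2⟩
        obtain ⟨rfl, h3⟩ := pairPoint_injective h1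
        obtain ⟨t, rfl⟩ := huniq v h3 h2
        refine Finset.mem_image.2 ⟨t, (hroot t).2 ?_, rfl⟩
        rw [f.vec_smul] at h3
        have h4 : (t ^ d - 1) • f.vec v₀ = 0 := by rw [sub_smul, h3, one_smul, sub_self]
        exact sub_eq_zero.1 ((smul_eq_zero.1 h4).resolve_right hf0))
    (Finset.card_image_le.trans (by
      rw [Polynomial.nthRootsFinset_def]
      exact (Multiset.toFinset_card_le _).trans (Polynomial.card_nthRoots d 1)))
    (by
      intro w hw w' hw' h
      obtain ⟨ζ, -, rfl⟩ := Finset.mem_image.1 hw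
      obtain ⟨ζ', -, rfl⟩ := Finset.mem_image.1 hw'
      have h : ζ * v₀ k = ζ' * v₀ k := by simpa [pairPoint] using h
      rw [mul_right_cancel₀ hk h])
    (by
      intro w hw
      obtain ⟨ζ, hζ, rfl⟩ := Finset.mem_image.1 hw
      have hζ := (hroot ζ).1 hζ
      have hζ0 : ζ ≠ 0 := by rintro rfl; simp [show d ≠ 0 by omega] at hζ
      refine (vanishingIdeal_pairPoint_le f A₀ (ζ • v₀) ?_).trans (sup_le_sup_right ?_ _)
      · rw [eval_smul_of_homogeneous f.jacobianDet_isHomogeneous]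
        exact mul_ne_zero (pow_ne_zero _ hζ0) hJ
      · have heq : ∀ i, MvPolynomial.eval (pairPoint A₀ (ζ • v₀)) (familyCoord f i)
            = MvPolynomial.eval (pairPoint A₀ v₀) (familyCoord f i) := by
          rw [← funext_iff, eval_familyCoord, eval_familyCoord, f.vec_smul, hζ, one_smul]
        simp only [heq]
        exact le_sup_left)
  rw [eval_familyCoord] at hD0
  refine ⟨D, hD0, fun A v v' hv hpv hpv' hff hDv => ?_⟩
  choose c h hch using fun j => hD (MvPolynomial.X (Sum.inr j))
  -- The factors `D` and `c j` depend only on `(A, f u)`, which is unchanged under `u ↦ ζ • u`. The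
  -- part linear in `ζ` expresses every coordinate of `u` through `u k`, so the fiber fixes the
  -- direction of `u`.
  have key : ∀ u, f.vec u = f.vec v → MvPolynomial.eval (A.mulVec u) p = 0 → ∀ j,
      MvPolynomial.eval (pairPoint A (f.vec v)) D * u j
        = MvPolynomial.eval (pairPoint A (f.vec v)) (c j ⟨1, hd⟩) * u k := by
    intro u hfu hpu j
    have := coeff_eq_of_forall_root_of_unity hd
      (fun i => MvPolynomial.eval (pairPoint A (f.vec v)) (c j i) * u k ^ (i : ℕ))
      (MvPolynomial.eval (pairPoint A (f.vec v)) D * u j) (by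
        intro ζ hζ
        have h1 := congrArg (MvPolynomial.eval (pairPoint A (ζ • u))) (hch j)
        simp only [map_mul, map_add, map_sum, map_pow, eval_aeval_eq_eval, eval_familyCoord,
          eval_genericTwist, hcone A u ζ hpu, f.vec_smul, hζ, one_smul, hfu, zero_mul, add_zero,
          MvPolynomial.eval_X] at h1
        simp only [pairPoint, Sum.elim_inr, Pi.smul_apply, smul_eq_mul, mul_pow] at h1
        rw [mul_left_comm]
        refine h1.trans (Finset.sum_congr rfl fun i _ => ?_)
        rw [mul_comm (ζ ^ (i : ℕ)), ← mul_assoc]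
        rfl)
    simpa using this
  have hvk : v k ≠ 0 := by
    intro h0
    apply hv
    funext j
    have := key v rfl hpv j
    rw [h0, mul_zero] at this
    exact (mul_eq_zero.1 this).resolve_left hDv
  refine ⟨v' k / v k, ?_⟩
  funext j
  have h1 := key v rfl hpv j
  have h2 := key v' hff.symm hpv' j
  apply mul_left_cancel₀ hDv
  rw [h2, Pi.smul_apply, smul_eq_mul, mul_left_comm, h1]
  field_simp

end Incidence

/-! ### Constructing one good matrix -/

theorem exists_eval_ne_zero {F σ : Type*} [Field F] [Infinite F] {p : MvPolynomial σ F}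
    (hp : p ≠ 0) : ∃ v, MvPolynomial.eval v p ≠ 0 := by
  by_contra! h
  exact hp (MvPolynomial.funext fun v => by simpa using h v)

/-- Each coordinate is a root of a monic polynomial whose coefficients depend only on `w`. -/
theorem finite_vec_fiber {F : Type*} [Field F] [IsAlgClosed F] {n d : ℕ} (hd : 1 ≤ d)
    (f : ProjEnd F n d) (w : Fin (n + 1) → F) : {v | f.vec v = w}.Finite := by
  choose P hP hPX using fun j => isIntegralElem_aeval_of_no_common_zero f.coord hd f.homogeneous
    f.no_common_zero (MvPolynomial.X j)
  refine (Set.Finite.pi' (t := fun j => {x | ((P j).map (MvPolynomial.eval w)).IsRoot x})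
    fun j => Polynomial.finite_setOfPred_isRoot ((hP j).map _).ne_zero).subset ?_
  rintro v rfl j
  have h1 := congrArg (MvPolynomial.eval v) (hPX j)
  rw [Polynomial.hom_eval₂, map_zero, MvPolynomial.eval_X] at h1
  rw [Set.mem_ofPred_eq, Polynomial.IsRoot.def, Polynomial.eval_map]
  convert! h1 using 2
  refine MvPolynomial.ringHom_ext (fun a => ?_) (fun i => ?_)
  · simp
  · simp [ProjEnd.vec]

theorem exists_det_ne_zero_mulVec_eq {F m : Type*} [Field F] [Fintype m] [DecidableEq m]
    {v u : m → F} (hv : v ≠ 0) (hu : u ≠ 0) :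
    ∃ M : Matrix m m F, M.det ≠ 0 ∧ M.mulVec v = u := by
  obtain ⟨g, hg⟩ := Submodule.exists_linearEquiv_restrict_eq
    ((LinearEquiv.toSpanNonzeroSingleton F _ v hv).symm.trans
      (LinearEquiv.toSpanNonzeroSingleton F _ u hu))
  refine ⟨LinearMap.toMatrix' g.toLinearMap, ?_, ?_⟩
  · rw [LinearMap.det_toMatrix']
    exact (LinearEquiv.isUnit_det' g).ne_zero
  · rw [← Matrix.toLin'_apply, Matrix.toLin'_toMatrix']
    have h1 := hg (LinearEquiv.toSpanNonzeroSingleton F _ v hv 1)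
    simp only [LinearEquiv.trans_apply, LinearEquiv.symm_apply_apply] at h1
    simpa using h1.symm

/-- Given `v ≠ 0`, `u ≠ 0` and finitely many vectors outside the line of `v`, some invertible matrix
maps `v` to `u` and those vectors off the zero locus of `p`. -/
theorem exists_matrix_avoiding {F m : Type*} [Field F] [Infinite F] [Fintype m] [DecidableEq m]
    {p : MvPolynomial m F} (hp : p ≠ 0) {v u : m → F} (hv : v ≠ 0) (hu : u ≠ 0)
    (E : Finset (m → F)) (hE : ∀ w ∈ E, ∀ t : F, w ≠ t • v) :
    ∃ A : Matrix m m F, A.det ≠ 0 ∧ A.mulVec v = u ∧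
      ∀ w ∈ E, MvPolynomial.eval (A.mulVec w) p ≠ 0 := by
  classical
  obtain ⟨k, hk⟩ := Function.ne_iff.1 hv
  replace hk : v k ≠ 0 := hk
  -- A rank-one correction retracts all matrices onto those sending `v` to `u`, so this affine space
  -- is parametrised polynomially and the open conditions become nonzero polynomials in `M`.
  let T : Matrix m m F → Matrix m m F := fun M =>
    M + Matrix.vecMulVec (u - M.mulVec v) (Pi.single k (v k)⁻¹)
  have hT : ∀ M w, (T M).mulVec w = M.mulVec (w - (w k / v k) • v) + (w k / v k) • u := by
    intro M w
    simp only [T, Matrix.add_mulVec, Matrix.vecMulVec_mulVec, Matrix.mulVec_sub,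
      Matrix.mulVec_smul, single_dotProduct]
    ext i
    simp
    field_simp
    ring
  have hTv : ∀ M, (T M).mulVec v = u := by
    intro M
    rw [hT, div_self hk]
    simp
  let TX : Matrix m m (MvPolynomial (m × m) F) := Matrix.of fun i j =>
    MvPolynomial.X (i, j) + (MvPolynomial.C (u i) -
      ∑ l, MvPolynomial.X (i, l) * MvPolynomial.C (v l)) *
      MvPolynomial.C ((Pi.single k (v k)⁻¹ : m → F) j)
  have hTX : ∀ M : Matrix m m F, (MvPolynomial.eval fun ij => M ij.1 ij.2).mapMatrix TX = T M := by
    intro M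
    ext i j
    simp [TX, T, Matrix.vecMulVec, Matrix.mulVec, dotProduct]
  let Q : (m → F) → MvPolynomial (m × m) F := fun w =>
    MvPolynomial.aeval (fun i => ∑ j, TX i j * MvPolynomial.C (w j)) p
  have hQ : ∀ M w, MvPolynomial.eval (fun ij : m × m => M ij.1 ij.2) (Q w)
      = MvPolynomial.eval ((T M).mulVec w) p := by
    intro M w
    rw [eval_aeval_eq_eval, ← hTX]
    congr 2
    funext i
    simp [Matrix.mulVec, dotProduct]
  have hdet : TX.det ≠ 0 := by
    obtain ⟨M, hM, hMv⟩ := exists_det_ne_zero_mulVec_eq hv hu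
    intro h0
    apply hM
    have h1 := congrArg (MvPolynomial.eval fun ij => M ij.1 ij.2) h0
    rw [RingHom.map_det, hTX, map_zero] at h1
    simpa [T, hMv] using h1
  have hQ0 : ∀ w ∈ E, Q w ≠ 0 := by
    intro w hw h0
    obtain ⟨c, hc⟩ := exists_eval_ne_zero hp
    have hne : w - (w k / v k) • v ≠ 0 := fun h => hE w hw _ (sub_eq_zero.1 h)
    obtain ⟨l, hl⟩ := Function.ne_iff.1 hne
    replace hl : (w - (w k / v k) • v) l ≠ 0 := hl
    apply hc
    -- This rank-one `M` is chosen so that `T M` sends `w` to `c`, where `p` does not vanish.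
    have h1 := hQ (Matrix.vecMulVec (c - (w k / v k) • u)
      (Pi.single l ((w - (w k / v k) • v) l)⁻¹)) w
    rw [h0, map_zero, hT, Matrix.vecMulVec_mulVec, single_dotProduct, inv_mul_cancel₀ hl] at h1
    simpa using h1.symm
  obtain ⟨M, hM⟩ := exists_eval_ne_zero (mul_ne_zero hdet (Finset.prod_ne_zero_iff.2 hQ0))
  rw [map_mul, map_prod, mul_ne_zero_iff, Finset.prod_ne_zero_iff] at hM
  refine ⟨T (Matrix.of fun i j => M (i, j)), ?_, hTv _, fun w hw => ?_⟩
  · rw [← hTX, ← RingHom.map_det]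
    exact hM.1
  · rw [← hQ]
    exact hM.2 w hw

/-- For a point `u` of the cone `p = 0` there is a matrix `A` such that `A⁻¹ u` is unramified and the
only point, up to scaling, of the cone `p (A x) = 0` in its fiber under `f`. -/
theorem exists_matrix_unique_in_fiber {F : Type*} [Field F] [IsAlgClosed F] {n d e : ℕ}
    (hd : 1 ≤ d) (f : ProjEnd F n d) (hJ : f.jacobianDet ≠ 0) {p : MvPolynomial (Fin (n + 1)) F}
    (hp0 : p ≠ 0) (hp : p.IsHomogeneous e) {u : Fin (n + 1) → F} (hu : u ≠ 0)
    (hpu : MvPolynomial.eval u p = 0) :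
    ∃ A : Matrix (Fin (n + 1)) (Fin (n + 1)) F, A.adjugate.mulVec u ≠ 0 ∧ A.det ≠ 0 ∧
      MvPolynomial.eval (A.adjugate.mulVec u) f.jacobianDet ≠ 0 ∧
      MvPolynomial.eval (A.mulVec (A.adjugate.mulVec u)) p = 0 ∧
      ∀ v, f.vec v = f.vec (A.adjugate.mulVec u) → MvPolynomial.eval (A.mulVec v) p = 0 →
        ∃ t : F, v = t • A.adjugate.mulVec u := by
  classical
  have := IsAlgClosed.instInfinite (K := F)
  -- The factor `X 0` serves only to force `v₁ ≠ 0`.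
  obtain ⟨v₁, hv₁⟩ := exists_eval_ne_zero (mul_ne_zero hJ (MvPolynomial.X_ne_zero (R := F) 0))
  rw [map_mul, MvPolynomial.eval_X, mul_ne_zero_iff] at hv₁
  have hv₁0 : v₁ ≠ 0 := by rintro rfl; exact hv₁.2 rfl
  obtain ⟨A, hA, hAv, hAE⟩ := exists_matrix_avoiding hp0 hv₁0 hu
    ((finite_vec_fiber hd f (f.vec v₁)).toFinset.filter fun w => ∀ t : F, w ≠ t • v₁)
    (fun w hw => (Finset.mem_filter.1 hw).2)
  have hadj : A.adjugate.mulVec u = A.det • v₁ := by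
    rw [← hAv, Matrix.mulVec_mulVec, Matrix.adjugate_mul, Matrix.smul_mulVec, Matrix.one_mulVec]
  refine ⟨A, ?_, hA, ?_, ?_, ?_⟩
  · rw [hadj]
    exact smul_ne_zero hA hv₁0
  · rw [hadj, eval_smul_of_homogeneous f.jacobianDet_isHomogeneous]
    exact mul_ne_zero (pow_ne_zero _ hA) hv₁.1
  · rw [hadj, Matrix.mulVec_smul, hAv, eval_smul_of_homogeneous hp, hpu, mul_zero]
  · intro v hv hpv
    rw [hadj] at hv ⊢
    by_contra! hne
    -- The adjugate replaces the inverse at the cost of a factor `A.det`; dividing by it returns to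
    -- the fiber of `v₁`, whose vectors off the line of `v₁` were avoided.
    have h1 : f.vec (A.det⁻¹ • v) = f.vec v₁ := by
      rw [f.vec_smul, hv, f.vec_smul, smul_smul, ← mul_pow, inv_mul_cancel₀ hA, one_pow, one_smul]
    refine hAE (A.det⁻¹ • v) (Finset.mem_filter.2 ⟨by simpa using h1, fun t ht => ?_⟩) ?_
    · apply hne t
      rw [smul_comm, ← ht, smul_smul, mul_inv_cancel₀ hA, one_smul]
    · rw [Matrix.mulVec_smul, eval_smul_of_homogeneous hp, hpv, mul_zero]

/-- Otherwise `q` would be associated to `X 0` and `X 0` would divide `X 1`. This is used to find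
nonzero vectors on `q = 0`. -/
theorem exists_not_dvd_X {F : Type*} [Field F] {n : ℕ} (hn : 1 ≤ n)
    {q : MvPolynomial (Fin (n + 1)) F} (hq : Prime q) :
    ∃ j, ¬ q ∣ MvPolynomial.X j := by
  by_contra! h
  have h0 := h 0
  have h1 := h ⟨1, by omega⟩
  have hirr : Irreducible (MvPolynomial.X 0 : MvPolynomial (Fin (n + 1)) F) :=
    MvPolynomial.X_prime.irreducible
  have hass := hq.irreducible.associated_of_dvd hirr h0
  obtain ⟨r, hr⟩ := hass.symm.dvd.trans h1
  have := congrArg (MvPolynomial.eval (Pi.single ⟨1, by omega⟩ 1)) hr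
  simp [Fin.ext_iff] at this

/-! ### The Zariski topology and continuity of `f` -/

theorem exists_basic_open_subset {F : Type*} [Field F] {n : ℕ} {O : Set (ProjSpace F n)}
    (hO : IsOpen O) {z : ProjSpace F n} (hz : z ∈ O) :
    ∃ (k : ℕ) (p : MvPolynomial (Fin (n + 1)) F), p.IsHomogeneous k ∧ z ∉ projZeroLocus p ∧
      (projZeroLocus p)ᶜ ⊆ O := by
  induction hO with
  | basic s hs =>
    obtain ⟨k, p, hp, rfl⟩ := hs
    exact ⟨k, p, hp, hz, subset_rfl⟩
  | univ =>
    exact ⟨0, 1, MvPolynomial.isHomogeneous_one _ _, by simp [projZeroLocus], Set.subset_univ _⟩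
  | inter s t _ _ hs ht =>
    obtain ⟨k, p, hp, hzp, hps⟩ := hs hz.1
    obtain ⟨l, q, hq, hzq, hqt⟩ := ht hz.2
    have key : ∀ P, P ∉ projZeroLocus (p * q) ↔ P ∉ projZeroLocus p ∧ P ∉ projZeroLocus q := by
      intro P
      simp [projZeroLocus]
    exact ⟨k + l, p * q, hp.mul hq, (key z).2 ⟨hzp, hzq⟩,
      fun P hP => ⟨hps ((key P).1 hP).1, hqt ((key P).1 hP).2⟩⟩
  | sUnion S _ ih =>
    obtain ⟨s, hs, hzs⟩ := hz
    obtain ⟨k, p, hp, hzp, hps⟩ := ih s hs hzs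
    exact ⟨k, p, hp, hzp, hps.trans (Set.subset_sUnion_of_mem hs)⟩

theorem ProjEnd.vec_ne_zero {F : Type*} [Field F] {n d : ℕ} (f : ProjEnd F n d)
    (v : Fin (n + 1) → F) (hv : v ≠ 0) : f.vec v ≠ 0 :=
  f.eval_ne_zero v hv

theorem ProjEnd.toFun_mk {F : Type*} [Field F] {n d : ℕ} (f : ProjEnd F n d)
    (v : Fin (n + 1) → F) (hv : v ≠ 0) :
    f (Projectivization.mk F v hv) = Projectivization.mk F (f.vec v) (f.vec_ne_zero v hv) := rfl

theorem ProjEnd.continuous {F : Type*} [Field F] {n d : ℕ} (f : ProjEnd F n d) :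
    Continuous f := by
  refine continuous_generateFrom_iff.2 ?_
  rintro _ ⟨k, p, hp, rfl⟩
  refine TopologicalSpace.isOpen_generateFrom_of_mem
    ⟨d * k, MvPolynomial.aeval f.coord p, hp.aeval _ f.homogeneous, ?_⟩
  ext P
  induction P using Projectivization.ind with
  | h v hv =>
    rw [Set.mem_preimage, Set.mem_compl_iff, Set.mem_compl_iff, f.toFun_mk,
      mk_mem_projZeroLocus hp, mk_mem_projZeroLocus (hp.aeval _ f.homogeneous), eval_aeval_eq_eval]
    rfl

/-- The open set of the points having a representative at which `D` does not vanish. -/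
def nonvanishingSet {F : Type*} [Field F] {n : ℕ} (D : MvPolynomial (Fin (n + 1)) F) :
    Set (ProjSpace F n) :=
  ⋃ k, (projZeroLocus (MvPolynomial.homogeneousComponent k D))ᶜ

theorem isOpen_nonvanishingSet {F : Type*} [Field F] {n : ℕ} (D : MvPolynomial (Fin (n + 1)) F) :
    IsOpen (nonvanishingSet D) :=
  isOpen_iUnion fun k => TopologicalSpace.isOpen_generateFrom_of_mem
    ⟨k, _, MvPolynomial.homogeneousComponent_isHomogeneous k D, rfl⟩

/-- Along the line of `w`, `D` is a polynomial in `t` whose coefficients are the values of its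
homogeneous components at `w`. -/
theorem mk_mem_nonvanishingSet {F : Type*} [Field F] [Infinite F] {n : ℕ}
    (D : MvPolynomial (Fin (n + 1)) F) (w : Fin (n + 1) → F) (hw : w ≠ 0) :
    Projectivization.mk F w hw ∈ nonvanishingSet D ↔
      ∃ t : F, t ≠ 0 ∧ MvPolynomial.eval (t • w) D ≠ 0 := by
  have hsum : ∀ t : F, MvPolynomial.eval (t • w) D = ∑ k ∈ Finset.range (D.totalDegree + 1),
      t ^ k * MvPolynomial.eval w (MvPolynomial.homogeneousComponent k D) := by
    intro t
    conv_lhs => rw [← MvPolynomial.sum_homogeneousComponent D, map_sum]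
    exact Finset.sum_congr rfl fun k _ =>
      eval_smul_of_homogeneous (MvPolynomial.homogeneousComponent_isHomogeneous k D) t w
  simp only [nonvanishingSet, Set.mem_iUnion, Set.mem_compl_iff,
    mk_mem_projZeroLocus (MvPolynomial.homogeneousComponent_isHomogeneous _ D)]
  constructor
  · rintro ⟨k, hk⟩
    set P : Polynomial F := ∑ k ∈ Finset.range (D.totalDegree + 1), Polynomial.monomial k
      (MvPolynomial.eval w (MvPolynomial.homogeneousComponent k D)) with hP
    have hkD : k < D.totalDegree + 1 := by
      by_contra! h
      rw [MvPolynomial.homogeneousComponent_eq_zero _ _ (by omega)] at hk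
      simp at hk
    -- The factor `X` forces the chosen `t` to be nonzero.
    have hP0 : P * Polynomial.X ≠ 0 := by
      refine mul_ne_zero (fun h => hk ?_) Polynomial.X_ne_zero
      have := congrArg (fun P => Polynomial.coeff P k) h
      simpa [hP, Polynomial.finsetSum_coeff, Polynomial.coeff_monomial, hkD] using this
    obtain ⟨t, ht⟩ : ∃ t, Polynomial.eval t (P * Polynomial.X) ≠ 0 := by
      by_contra! h
      exact hP0 (Polynomial.funext fun t => by simpa using h t)
    rw [Polynomial.eval_mul, Polynomial.eval_X, mul_ne_zero_iff] at ht
    refine ⟨t, ht.2, ?_⟩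
    rw [hsum]
    convert! ht.1 using 1
    rw [hP, Polynomial.eval_finsetSum]
    exact Finset.sum_congr rfl fun k _ => by rw [Polynomial.eval_monomial, mul_comm]
  · rintro ⟨t, -, ht⟩
    by_contra! h
    exact ht (by rw [hsum]; simp [h])

/-! ### Moving the hypersurface by a varying matrix -/

theorem mem_image_smul_projZeroLocus {F : Type*} [Field F] {n e : ℕ}
    {p : MvPolynomial (Fin (n + 1)) F} (hp : p.IsHomogeneous e)
    {A : Matrix (Fin (n + 1)) (Fin (n + 1)) F} (hA : A.det ≠ 0)
    (v : Fin (n + 1) → F) (hv : v ≠ 0) :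
    Projectivization.mk F v hv ∈ (fun P => (Matrix.ProjGenLinGroup.mk
      (Matrix.GeneralLinearGroup.mkOfDetNeZero A hA))⁻¹ • P) '' projZeroLocus p ↔
      MvPolynomial.eval (A.mulVec v) p = 0 := by
  set g := Matrix.GeneralLinearGroup.mkOfDetNeZero A hA
  rw [show (fun P : ProjSpace F n => (Matrix.ProjGenLinGroup.mk g)⁻¹ • P) '' projZeroLocus p
    = (fun P : ProjSpace F n => Matrix.ProjGenLinGroup.mk g • P) ⁻¹' projZeroLocus p from ?_]
  · rw [Set.mem_preimage, Projectivization.PGL.mk_smul_mk, mk_mem_projZeroLocus hp]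
    rfl
  · ext P
    constructor
    · rintro ⟨Q, hQ, rfl⟩
      simpa using hQ
    · intro h
      exact ⟨_, h, by simp⟩

/-- The polynomial in the entries of `A` whose value at `A` is `D (A, f (adj A u))`. -/
noncomputable def adjugatePullback {F : Type*} [Field F] {n d : ℕ} (f : ProjEnd F n d)
    (u : Fin (n + 1) → F) (D : MvPolynomial ((Fin (n + 1) × Fin (n + 1)) ⊕ Fin (n + 1)) F) :
    MvPolynomial (Fin (n + 1) × Fin (n + 1)) F :=
  MvPolynomial.aeval (Sum.elim MvPolynomial.X fun i => MvPolynomial.aeval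
    (fun a => ∑ b, (Matrix.of fun i j => MvPolynomial.X (i, j)).adjugate a b * MvPolynomial.C (u b))
    (f.coord i)) D

theorem eval_adjugatePullback {F : Type*} [Field F] {n d : ℕ} (f : ProjEnd F n d)
    (u : Fin (n + 1) → F) (D : MvPolynomial ((Fin (n + 1) × Fin (n + 1)) ⊕ Fin (n + 1)) F)
    (A : Matrix (Fin (n + 1)) (Fin (n + 1)) F) :
    MvPolynomial.eval (fun ij => A ij.1 ij.2) (adjugatePullback f u D)
      = MvPolynomial.eval (pairPoint A (f.vec (A.adjugate.mulVec u))) D := by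
  rw [adjugatePullback, eval_aeval_eq_eval]
  congr 2
  funext x
  rcases x with ij | i
  · simp [pairPoint]
  · simp only [pairPoint, Sum.elim_inr, ProjEnd.vec, eval_aeval_eq_eval]
    congr 2
    funext a
    have h1 := RingHom.map_adjugate (MvPolynomial.eval fun ij : Fin (n + 1) × Fin (n + 1) =>
      A ij.1 ij.2) (Matrix.of fun i j => MvPolynomial.X (i, j))
    have h2 : (MvPolynomial.eval fun ij : Fin (n + 1) × Fin (n + 1) => A ij.1 ij.2).mapMatrix
        (Matrix.of fun i j => MvPolynomial.X (i, j)) = A := by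
      ext i j
      simp
    rw [h2] at h1
    simp only [map_sum, map_mul, MvPolynomial.eval_C, Matrix.mulVec, dotProduct, ← h1]
    rfl

/-- Some automorphism moves a hypersurface to one on which `f` is generically injective. -/
theorem exists_generically_one_to_one {F : Type*} [Field F] [IsAlgClosed F] [CharZero F] {n d : ℕ}
    (hn : 1 ≤ n) (hd : 2 ≤ d) (f : ProjEnd F n d) (hJ : f.jacobianDet ≠ 0)
    (H : Set (ProjSpace F n)) (hH : IsHypersurface H) :
    ∃ α : Matrix.ProjGenLinGroup (Fin (n + 1)) F,
      GenericallyToOne f ((fun P => α • P) '' H) 1 := by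
  classical
  have := IsAlgClosed.instInfinite (K := F)
  obtain ⟨e, p, -, hp0, hp, rfl⟩ := hH
  set S := (UniqueFactorizationMonoid.factors p).toFinset with hS
  have hprime : ∀ q ∈ S, Prime q := fun q hq =>
    UniqueFactorizationMonoid.prime_of_factor q (Multiset.mem_toFinset.1 hq)
  have hdvd : ∀ q ∈ S, q ∣ p := fun q hq =>
    UniqueFactorizationMonoid.dvd_of_mem_factors (Multiset.mem_toFinset.1 hq)
  have hfac : ∀ u, MvPolynomial.eval u p = 0 → ∃ q ∈ S, MvPolynomial.eval u q = 0 := by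
    intro u hu
    obtain ⟨c, hc⟩ := UniqueFactorizationMonoid.factors_prod hp0
    rw [← hc, map_mul, map_multiset_prod, mul_eq_zero] at hu
    rcases hu with hu | hu
    · obtain ⟨q, hq, hqu⟩ := Multiset.mem_map.1 (Multiset.prod_eq_zero_iff.1 hu)
      exact ⟨q, Multiset.mem_toFinset.2 hq, hqu⟩
    · exact absurd hu ((c.isUnit.map (MvPolynomial.eval u)).ne_zero)
  have hzero : ∀ q ∈ S, ∀ u, MvPolynomial.eval u q = 0 → MvPolynomial.eval u p = 0 := by
    intro q hq u hu
    obtain ⟨r, rfl⟩ := hdvd q hq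
    rw [map_mul, hu, zero_mul]
  -- One good pair per irreducible factor `q`; uniqueness is nevertheless among all points of `p (A
  -- x) = 0`, not just those of the component `q`.
  have hlocal : ∀ q : S, ∃ (u : Fin (n + 1) → F)
      (D : MvPolynomial ((Fin (n + 1) × Fin (n + 1)) ⊕ Fin (n + 1)) F),
      MvPolynomial.eval u q.1 = 0 ∧ adjugatePullback f u D ≠ 0 ∧
      ∀ A v v', v ≠ 0 → MvPolynomial.eval (A.mulVec v) p = 0 →
        MvPolynomial.eval (A.mulVec v') p = 0 → f.vec v = f.vec v' →
        MvPolynomial.eval (pairPoint A (f.vec v)) D ≠ 0 → ∃ t : F, v' = t • v := by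
    rintro ⟨q, hq⟩
    obtain ⟨j, hj⟩ := exists_not_dvd_X hn (hprime q hq)
    obtain ⟨u, hu, huj⟩ := exists_eval_eq_zero_and_ne_zero_of_prime (hprime q hq) hj
    rw [MvPolynomial.eval_X] at huj
    have hu0 : u ≠ 0 := by rintro rfl; exact huj rfl
    obtain ⟨A, hv0, -, hJv, hpv, huniq⟩ := exists_matrix_unique_in_fiber (by omega) f hJ hp0 hp hu0
      (hzero q hq u hu)
    obtain ⟨D, hD, hDu⟩ := exists_uniqueness_neighbourhood hd f hp A _ hv0 hJv hpv huniq
    refine ⟨u, D, hu, fun h => hD ?_, hDu⟩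
    rw [← eval_adjugatePullback, h, map_zero]
  choose u D huq hW hDu using hlocal
  have hdetX : (Matrix.of fun i j => (MvPolynomial.X (i, j) :
      MvPolynomial (Fin (n + 1) × Fin (n + 1)) F)).det ≠ 0 := by
    intro h
    have h1 := congrArg (MvPolynomial.eval fun ij : Fin (n + 1) × Fin (n + 1) =>
      (1 : Matrix (Fin (n + 1)) (Fin (n + 1)) F) ij.1 ij.2) h
    rw [RingHom.map_det, map_zero] at h1
    refine one_ne_zero ((Matrix.det_one (n := Fin (n + 1)) (R := F)).symm.trans (Eq.trans ?_ h1))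
    congr 1
    ext i j
    simp
  -- The space of matrices is irreducible, so one invertible matrix meets the conditions of all
  -- components.
  obtain ⟨M, hM⟩ := exists_eval_ne_zero (mul_ne_zero hdetX
    (Finset.prod_ne_zero_iff (s := Finset.univ).2 fun q _ => hW q))
  set A : Matrix (Fin (n + 1)) (Fin (n + 1)) F := Matrix.of fun i j => M (i, j) with hAdef
  have hMA : M = fun ij => A ij.1 ij.2 := rfl
  rw [map_mul, map_prod, mul_ne_zero_iff, Finset.prod_ne_zero_iff] at hM
  have hA : A.det ≠ 0 := by
    have h1 := hM.1
    rw [RingHom.map_det] at h1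
    convert! h1 using 2
    ext i j
    simp [hAdef]
  have hDA : ∀ q, MvPolynomial.eval (pairPoint A (f.vec (A.adjugate.mulVec (u q)))) (D q) ≠ 0 := by
    intro q
    rw [← eval_adjugatePullback, ← hMA]
    exact hM.2 q (Finset.mem_univ q)
  have hadj : ∀ y, A.mulVec (A.adjugate.mulVec y) = A.det • y := fun y => by
    rw [Matrix.mulVec_mulVec, Matrix.mul_adjugate, Matrix.smul_mulVec, Matrix.one_mulVec]
  have hadj' : ∀ y, A.adjugate.mulVec (A.mulVec y) = A.det • y := fun y => by
    rw [Matrix.mulVec_mulVec, Matrix.adjugate_mul, Matrix.smul_mulVec, Matrix.one_mulVec]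
  let DA : S → MvPolynomial (Fin (n + 1)) F := fun q =>
    MvPolynomial.aeval (Sum.elim (fun ij => MvPolynomial.C (A ij.1 ij.2)) MvPolynomial.X) (D q)
  have hDAeval : ∀ q w, MvPolynomial.eval w (DA q) = MvPolynomial.eval (pairPoint A w) (D q) := by
    intro q w
    rw [eval_aeval_eq_eval]
    congr 2
    funext x
    rcases x with ij | i <;> simp [pairPoint]
  set U : Set (ProjSpace F n) := ⋃ q, nonvanishingSet (DA q) with hU
  have hZ := mem_image_smul_projZeroLocus hp hA
  refine ⟨(Matrix.ProjGenLinGroup.mk (Matrix.GeneralLinearGroup.mkOfDetNeZero A hA))⁻¹, U,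
    isOpen_iUnion fun q => isOpen_nonvanishingSet _, ?_, ?_⟩
  · set Z := (fun P => (Matrix.ProjGenLinGroup.mk
      (Matrix.GeneralLinearGroup.mkOfDetNeZero A hA))⁻¹ • P) '' projZeroLocus p with hZdef
    -- By continuity of `f`, density may be checked on the source.
    suffices hdense : Z ⊆ closure (Z ∩ f ⁻¹' U) by
      refine (Set.image_mono hdense).trans ((image_closure_subset_closure_image f.continuous).trans
        (closure_mono ?_))
      rintro _ ⟨P, hP, rfl⟩
      exact ⟨⟨P, hP.1, rfl⟩, hP.2⟩
    intro z hz
    induction z using Projectivization.ind with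
    | h v hv =>
    rw [mem_closure_iff]
    intro O hO hzO
    obtain ⟨k, h, hh, hvh, hhO⟩ := exists_basic_open_subset hO hzO
    rw [mk_mem_projZeroLocus hh] at hvh
    obtain ⟨q, hq, hqv⟩ := hfac _ ((hZ v hv).1 hz)
    let adj : Fin (n + 1) → MvPolynomial (Fin (n + 1)) F :=
      fun i => ∑ j, MvPolynomial.C (A.adjugate i j) * MvPolynomial.X j
    have hadjeval : ∀ y r, MvPolynomial.eval y (MvPolynomial.aeval adj r)
        = MvPolynomial.eval (A.adjugate.mulVec y) r := by
      intro y r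
      rw [eval_aeval_eq_eval]
      congr 2
      funext i
      simp [adj, Matrix.mulVec, dotProduct]
    have hnd : ∀ y r, MvPolynomial.eval y q = 0 → MvPolynomial.eval y r ≠ 0 → ¬ q ∣ r := by
      rintro y _ hy hr ⟨c, rfl⟩
      exact hr (by rw [map_mul, hy, zero_mul])
    have hvec : ∀ y, MvPolynomial.eval y (MvPolynomial.aeval adj (MvPolynomial.aeval f.coord
        (DA ⟨q, hq⟩))) = MvPolynomial.eval (pairPoint A (f.vec (A.adjugate.mulVec y)))
          (D ⟨q, hq⟩) := by
      intro y
      rw [hadjeval, eval_aeval_eq_eval, ← hDAeval]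
      rfl
    obtain ⟨j, hj⟩ := exists_not_dvd_X hn (hprime q hq)
    have h1 : ¬ q ∣ MvPolynomial.aeval adj h := by
      refine hnd _ _ hqv ?_
      rw [hadjeval, hadj', eval_smul_of_homogeneous hh]
      exact mul_ne_zero (pow_ne_zero _ hA) hvh
    have h2 : ¬ q ∣ MvPolynomial.aeval adj (MvPolynomial.aeval f.coord (DA ⟨q, hq⟩)) := by
      refine hnd (u ⟨q, hq⟩) _ (huq ⟨q, hq⟩) ?_
      rw [hvec]
      exact hDA _
    -- On the irreducible locus `q = 0` three nonempty open conditions have a common point: lying in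
    -- the given neighbourhood, lying over `U`, and being nonzero.
    obtain ⟨y, hy, hy'⟩ := exists_eval_eq_zero_and_ne_zero_of_prime (hprime q hq)
      ((hprime q hq).not_dvd_mul ((hprime q hq).not_dvd_mul h1 h2) hj)
    rw [map_mul, map_mul, mul_ne_zero_iff, mul_ne_zero_iff, hvec, hadjeval,
      MvPolynomial.eval_X] at hy'
    obtain ⟨⟨hy1, hy2⟩, hy3⟩ := hy'
    have hx0 : A.adjugate.mulVec y ≠ 0 := by
      intro h0
      have h3 := hadj y
      rw [h0, Matrix.mulVec_zero] at h3
      exact hy3 (by rw [(smul_eq_zero.1 h3.symm).resolve_left hA]; rfl)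
    refine ⟨Projectivization.mk F (A.adjugate.mulVec y) hx0, hhO ?_, ?_, ?_⟩
    · rwa [Set.mem_compl_iff, mk_mem_projZeroLocus hh]
    · rw [hZ, hadj, eval_smul_of_homogeneous hp, hzero q hq y hy, mul_zero]
    · rw [Set.mem_preimage, f.toFun_mk, hU, Set.mem_iUnion]
      refine ⟨⟨q, hq⟩, (mk_mem_nonvanishingSet _ _ _).2 ⟨1, one_ne_zero, ?_⟩⟩
      rwa [one_smul, hDAeval]
  · rintro _ ⟨⟨P, hP, rfl⟩, hPU⟩
    rw [Nat.cast_one, Set.encard_eq_one]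
    refine ⟨P, Set.eq_singleton_iff_unique_mem.2 ⟨⟨hP, rfl⟩, ?_⟩⟩
    rintro P' ⟨hP', hff⟩
    induction P using Projectivization.ind with
    | h v hv =>
    induction P' using Projectivization.ind with
    | h v' hv' =>
    have hd0 : 0 < d := by omega
    rw [Set.mem_preimage, Set.mem_singleton_iff, f.toFun_mk, f.toFun_mk,
      Projectivization.mk_eq_mk_iff'] at hff
    obtain ⟨c, hc⟩ := hff
    rw [hZ] at hP hP'
    rw [f.toFun_mk, hU, Set.mem_iUnion] at hPU
    obtain ⟨q, hq⟩ := hPU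
    obtain ⟨t, ht, hqt⟩ := (mk_mem_nonvanishingSet _ _ _).1 hq
    rw [hDAeval] at hqt
    have hc0 : c ≠ 0 := by
      rintro rfl
      rw [zero_smul] at hc
      exact f.vec_ne_zero v' hv' hc.symm
    -- Equal projective images only give proportional vectors. Rescaling by `d`-th roots makes both
    -- images equal to `t • f.vec v`, where `D q` is nonzero.
    obtain ⟨s, hs⟩ := IsAlgClosed.exists_pow_nat_eq t hd0
    obtain ⟨r, hr⟩ := IsAlgClosed.exists_pow_nat_eq (t * c⁻¹) hd0
    have hs0 : s ≠ 0 := by rintro rfl; exact ht (by rw [← hs, zero_pow hd0.ne'])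
    have hr0 : r ≠ 0 := by
      rintro rfl
      rw [zero_pow hd0.ne'] at hr
      exact mul_ne_zero ht (inv_ne_zero hc0) hr.symm
    have hscale : ∀ (t : F) w, MvPolynomial.eval (A.mulVec w) p = 0 →
        MvPolynomial.eval (A.mulVec (t • w)) p = 0 := by
      intro t w hw
      rw [Matrix.mulVec_smul, eval_smul_of_homogeneous hp, hw, mul_zero]
    obtain ⟨x, hx⟩ := hDu q A (s • v) (r • v') (smul_ne_zero hs0 hv) (hscale s v hP)
      (hscale r v' hP') (by
        rw [f.vec_smul, f.vec_smul, hs, hr, ← hc, smul_smul, mul_assoc, inv_mul_cancel₀ hc0,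
          mul_one]) (by rwa [f.vec_smul, hs])
    rw [Projectivization.mk_eq_mk_iff']
    refine ⟨r⁻¹ * (x * s), ?_⟩
    rw [mul_smul, mul_smul, ← hx, smul_smul, inv_mul_cancel₀ hr0, one_smul]

theorem lemma28 {F : Type*} [Field F] [IsAlgClosed F] [CharZero F] (n d r : ℕ)
    (hn : 2 ≤ n) (hd : 2 ≤ d) (hr : 2 ≤ r)
    (f : ProjEnd F n d) (H : Set (ProjSpace F n)) (hH : IsHypersurface H)
    (hHC : ¬ H ⊆ f.critLocus)
    (hHB : ¬ f '' H ⊆ f.branchLocus)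
    (hfH : GenericallyToOne f H r) :
    (∃ s : ℕ, 1 ≤ s ∧ s < r ∧ ∃ α : Matrix.ProjGenLinGroup (Fin (n + 1)) F,
      GenericallyToOne f ((fun P => α • P) '' H) s) ∧
    (∃ α : Matrix.ProjGenLinGroup (Fin (n + 1)) F,
      GenericallyToOne f ((fun P => α • P) '' H) 1) := by
  -- A zero Jacobian determinant would make every point critical.
  have hJ : f.jacobianDet ≠ 0 := by
    intro h
    refine hHC fun P _ => ?_
    simp [ProjEnd.critLocus, projZeroLocus, h]
  have hone := exists_generically_one_to_one (by omega) hd f hJ H hH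
  exact ⟨⟨1, le_rfl, hr, hone⟩, hone⟩
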